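/- Let $\mathcal H$ be a separable complex Hilbert space of infinite dimension, let $(Z,\mathcal X)$ be an uncountable standard Borel space, and for each point $[\psi]$ of the projective space $\mathbb P(\mathcal H)$ let $\mu_{[\psi]}$ be a probability measure on $Z$ with $\mu_{[\psi]}(\{z\})=0$ for all $z\in Z$. For a (possibly unbounded) self-adjoint operator $A$ on $\mathcal H$ let $E^A$ be its projection-valued spectral measure on the Borel sets of $\mathbb R$, so that $A=\int_{\mathbb R} r\,dE^A(r)$. For a unit vector $\psi$ let $F^A_\psi(r)=\langle\psi,E^A_{(-\infty,r]}\psi\rangle$, and let $\nu_{F^A_\psi}$ be the Borel measure on $\mathbb R$ with $\nu_{F^A_\psi}(]a,b])=F^A_\psi(b)-F^A_\psi(a)$ for $a<b$. For a Borel function $b:\mathbb R\to\mathbb R$ let $b\circ A=b(A)=\int_{\mathbb R} b\,dE^A$, with domain $\{x\in\mathcal H:\int|b|^2\,d\langle x,E^A(\cdot)x\rangle<\infty\}$. A function $f:\mathbb P(\mathcal H)\times Z\to\mathbb R$ is called an observable function if each section $f_{[\psi]}=f([\psi],\cdot):Z\to\mathbb R$ is Borel and there is a self-adjoint operator $A$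 on $\mathcal H$ such that the image measure satisfies $(f_{[\psi]})_*\mu_{[\psi]}=\nu_{F^A_\psi}$ for every $[\psi]\in\mathbb P(\mathcal H)$ (where $\|\psi\|=1$). This $A$ is uniquely determined by $f$ and is denoted $Op(f)$. Theorem. For each observable function $f$ and each Borel function $b:\mathbb R\to\mathbb R$ the composition $b\circ f$ is an observable function, and $Op(b\circ f)=b\circ Op(f)$, the Borel functional calculus of $b$ applied to $Op(f)$ (equality of operators, domains included). -/

import Mathlib

open MeasureTheory Filter Topology Set
open scoped InnerProductSpace ENNReal LinearAlgebra.Projectivization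

noncomputable section

/-- A projection-valued measure on the Borel sets of the real line, with values in the orthogonal
projections of the Hilbert space `H`. The value on a set that is not Borel is the junk value `0`. -/
structure SpectralResolution (H : Type*) [NormedAddCommGroup H] [InnerProductSpace ℂ H]
    [CompleteSpace H] where
  toFun : Set ℝ → H →L[ℂ] H
  not_measurable' : ∀ B, ¬ MeasurableSet B → toFun B = 0
  isStarProjection' : ∀ B, MeasurableSet B → IsStarProjection (toFun B)
  univ' : toFun univ = 1
  inter' : ∀ B C, MeasurableSet B → MeasurableSet C → toFun (B ∩ C) = toFun B * toFun C
  hasSum' : ∀ B : ℕ → Set ℝ, (∀ n, MeasurableSet (B n)) → Pairwise (fun m n => Disjoint (B m) (B n)) →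
    ∀ x : H, HasSum (fun n => toFun (B n) x) (toFun (⋃ n, B n) x)

namespace SpectralResolution

variable {H : Type*} [NormedAddCommGroup H] [InnerProductSpace ℂ H] [CompleteSpace H]

theorem inner_apply (E : SpectralResolution H) {B : Set ℝ} (hB : MeasurableSet B) (x y : H) :
    ⟪x, E.toFun B y⟫_ℂ = ⟪E.toFun B x, E.toFun B y⟫_ℂ := by
  have h := E.isStarProjection' B hB
  have h1 : E.toFun B (E.toFun B y) = E.toFun B y :=
    congrArg (fun T : H →L[ℂ] H => T y) h.isIdempotentElem
  have h2 := h.isSelfAdjoint.isSymmetric x (E.toFun B y)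
  simp only [ContinuousLinearMap.coe_coe] at h2
  rw [h2, h1]

theorem re_inner_apply (E : SpectralResolution H) {B : Set ℝ} (hB : MeasurableSet B) (x : H) :
    (⟪x, E.toFun B x⟫_ℂ).re = ‖E.toFun B x‖ ^ 2 := by
  rw [E.inner_apply hB, inner_self_eq_norm_sq_to_K]
  norm_cast

theorem empty (E : SpectralResolution H) : E.toFun ∅ = 0 := by
  ext x
  have h := E.hasSum' (fun _ => ∅) (fun _ => MeasurableSet.empty) (fun _ _ _ => disjoint_bot_left) x
  simpa using (summable_const_iff _).1 h.summable

/-- The scalar measure `B ↦ ⟪x, E(B) x⟫`. -/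
def measure (E : SpectralResolution H) (x : H) : Measure ℝ :=
  Measure.ofMeasurable (fun B _ => ENNReal.ofReal (⟪x, E.toFun B x⟫_ℂ).re)
    (by simp [E.empty])
    (by
      intro B hB hd
      have h := (E.hasSum' B hB hd x).mapL (Complex.reCLM.restrictScalars ℝ ∘L
        (innerSL ℂ x).restrictScalars ℝ)
      have h' : HasSum (fun n => (⟪x, E.toFun (B n) x⟫_ℂ).re) (⟪x, E.toFun (⋃ n, B n) x⟫_ℂ).re := h
      rw [← h'.tsum_eq, ENNReal.ofReal_tsum_of_nonneg _ h'.summable]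
      intro n
      rw [E.re_inner_apply (hB n)]
      positivity)

theorem measure_apply (E : SpectralResolution H) (x : H) {B : Set ℝ} (hB : MeasurableSet B) :
    E.measure x B = ENNReal.ofReal (⟪x, E.toFun B x⟫_ℂ).re :=
  Measure.ofMeasurable_apply _ hB

theorem measure_apply' (E : SpectralResolution H) (x : H) {B : Set ℝ} (hB : MeasurableSet B) :
    E.measure x B = ENNReal.ofReal (‖E.toFun B x‖ ^ 2) := by
  rw [E.measure_apply x hB, E.re_inner_apply hB]

instance (E : SpectralResolution H) (x : H) : IsFiniteMeasure (E.measure x) :=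
  ⟨by rw [E.measure_apply x MeasurableSet.univ]; exact ENNReal.ofReal_lt_top⟩

theorem measureReal_apply (E : SpectralResolution H) (x : H) {B : Set ℝ} (hB : MeasurableSet B) :
    (E.measure x).real B = (⟪x, E.toFun B x⟫_ℂ).re := by
  rw [Measure.real, E.measure_apply x hB, ENNReal.toReal_ofReal]
  rw [E.re_inner_apply hB]; positivity

/-- The cumulative function `r ↦ ⟪x, E((-∞, r]) x⟫`. -/
def cumulative (E : SpectralResolution H) (x : H) : StieltjesFunction ℝ where
  toFun r := (⟪x, E.toFun (Iic r) x⟫_ℂ).re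
  mono' := by
    intro r s h
    simp only [← E.measureReal_apply x measurableSet_Iic]
    exact measureReal_mono (Iic_subset_Iic.2 h)
  right_continuous' := by
    intro r
    simp only [← E.measureReal_apply x measurableSet_Iic]
    rw [continuousWithinAt_Ioi_iff_Ici.symm]
    have h := tendsto_measure_biInter_gt (μ := E.measure x) (s := fun t : ℝ => Iic t) (a := r)
      (fun _ _ => measurableSet_Iic.nullMeasurableSet) (fun _ _ _ h => Iic_subset_Iic.2 h)
      ⟨r + 1, by simp, measure_ne_top _ _⟩
    have h2 : (⋂ t > r, Iic t) = Iic r := by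
      ext t
      simp only [mem_iInter, mem_Iic]
      exact ⟨fun h => le_of_forall_gt_imp_ge_of_dense h, fun h u hu => h.trans hu.le⟩
    rw [h2] at h
    exact (ENNReal.tendsto_toReal (measure_ne_top _ _)).comp h

/-- The integral `∑ c, c • E({s = c})` of a simple function `s`. -/
def simpleIntegral (E : SpectralResolution H) (s : SimpleFunc ℝ ℝ) : H →L[ℂ] H :=
  ∑ c ∈ s.range, (c : ℂ) • E.toFun (s ⁻¹' {c})

theorem norm_simpleIntegral (E : SpectralResolution H) (s : SimpleFunc ℝ ℝ) (x : H) :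
    ENNReal.ofReal (‖E.simpleIntegral s x‖) = eLpNorm s 2 (E.measure x) := by
  have h1 : ‖E.simpleIntegral s x‖ ^ 2 =
      ∑ c ∈ s.range, c ^ 2 * (⟪x, E.toFun (s ⁻¹' {c}) x⟫_ℂ).re := by
    have ho : ∀ c ∈ s.range, ∀ d ∈ s.range, c ≠ d →
        ⟪E.toFun (s ⁻¹' {c}) x, E.toFun (s ⁻¹' {d}) x⟫_ℂ = 0 := by
      intro c _ d _ hcd
      have h := (E.isStarProjection' _ (s.measurableSet_fiber c)).isSelfAdjoint.isSymmetric x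
        (E.toFun (s ⁻¹' {d}) x)
      simp only [ContinuousLinearMap.coe_coe] at h
      have h' := E.inter' _ _ (s.measurableSet_fiber c) (s.measurableSet_fiber d)
      have he : s ⁻¹' {c} ∩ s ⁻¹' {d} = ∅ := by
        ext t
        simp only [mem_inter_iff, mem_preimage, mem_singleton_iff, mem_empty_iff_false, iff_false]
        exact fun h => hcd (h.1.symm.trans h.2)
      rw [he, E.empty] at h'
      have h'' : E.toFun (s ⁻¹' {c}) (E.toFun (s ⁻¹' {d}) x) = 0 :=
        (congrArg (fun T : H →L[ℂ] H => T x) h').symm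
      rw [h, h'', inner_zero_right]
    have h2 : (⟪E.simpleIntegral s x, E.simpleIntegral s x⟫_ℂ).re =
        ∑ c ∈ s.range, c ^ 2 * (⟪x, E.toFun (s ⁻¹' {c}) x⟫_ℂ).re := by
      simp only [simpleIntegral, sum_inner, inner_sum, sum_apply,
        smul_apply, Complex.re_sum]
      refine Finset.sum_congr rfl fun c hc => ?_
      rw [Finset.sum_eq_single c]
      · rw [inner_smul_left, inner_smul_right, ← E.inner_apply (s.measurableSet_fiber c),
          Complex.conj_ofReal, ← mul_assoc, ← Complex.ofReal_mul, Complex.re_ofReal_mul, sq]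
      · intro d hd hdc
        rw [inner_smul_left, inner_smul_right, ho _ hd _ hc hdc]
        simp
      · exact fun h => absurd hc h
    rw [← h2, inner_self_eq_norm_sq_to_K]
    norm_cast
  have h3 : ∫⁻ t, ‖s t‖ₑ ^ 2 ∂(E.measure x) = ENNReal.ofReal (‖E.simpleIntegral s x‖ ^ 2) := by
    have h4 : ∫⁻ t, ‖s t‖ₑ ^ 2 ∂(E.measure x) =
        (s.map (fun c => ‖c‖ₑ ^ 2)).lintegral (E.measure x) := by
      rw [← SimpleFunc.lintegral_eq_lintegral]
      simp
    rw [h4, SimpleFunc.map_lintegral, h1, ENNReal.ofReal_sum_of_nonneg]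
    · refine Finset.sum_congr rfl fun c _ => ?_
      rw [E.measure_apply x (s.measurableSet_fiber c), ENNReal.ofReal_mul (sq_nonneg c),
        ← sq_abs c, ENNReal.ofReal_pow (abs_nonneg c), ← Real.norm_eq_abs, ofReal_norm]
    · intro c _
      rw [E.re_inner_apply (s.measurableSet_fiber c)]
      positivity
  rw [eLpNorm_eq_lintegral_rpow_enorm_toReal (by norm_num) (by norm_num)]
  simp only [ENNReal.toReal_ofNat, ENNReal.rpow_ofNat]
  rw [h3, ENNReal.ofReal_pow (norm_nonneg _), ← ENNReal.rpow_natCast, ← ENNReal.rpow_mul]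
  norm_num

theorem simpleIntegral_sub (E : SpectralResolution H) (s t : SimpleFunc ℝ ℝ) (x : H) :
    E.simpleIntegral (s - t) x = E.simpleIntegral s x - E.simpleIntegral t x := by
  let T : Set ℝ → ℝ →L[ℝ] H := fun B => (ContinuousLinearMap.id ℝ ℝ).smulRight (E.toFun B x)
  have hT : FinMeasAdditive (E.measure x) T := by
    intro B C hB hC _ _ hd
    have h : E.toFun (B ∪ C) x = E.toFun B x + E.toFun C x := by
      have h := E.hasSum' (fun n => if n = 0 then B else if n = 1 then C else ∅)
        (by intro n; split_ifs <;> simp [hB, hC])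
        (by
          intro m n hmn
          split_ifs <;> simp_all [disjoint_comm])
        x
      have hU : (⋃ n : ℕ, if n = 0 then B else if n = 1 then C else ∅) = B ∪ C := by
        ext t
        simp only [mem_iUnion, mem_union]
        constructor
        · rintro ⟨n, hn⟩
          split_ifs at hn
          · exact Or.inl hn
          · exact Or.inr hn
          · exact absurd hn (by simp)
        · rintro (h | h)
          · exact ⟨0, by simpa using h⟩
          · exact ⟨1, by simpa using h⟩
      rw [hU] at h
      rw [← h.tsum_eq, tsum_eq_sum (s := {0, 1})]
      · simp
      · intro n hn
        simp only [Finset.mem_insert, Finset.mem_singleton, not_or] at hn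
        simp [hn.1, hn.2, E.empty]
    ext
    simp [T, h]
  have hI : ∀ u : SimpleFunc ℝ ℝ, E.simpleIntegral u x = u.setToSimpleFunc T := by
    intro u
    simp [simpleIntegral, SimpleFunc.setToSimpleFunc, T]
  simp only [hI]
  exact SimpleFunc.setToSimpleFunc_sub T hT (SimpleFunc.integrable_of_isFiniteMeasure s)
    (SimpleFunc.integrable_of_isFiniteMeasure t)

/-- The standard sequence of simple functions that tends pointwise to `b`. -/
def approx (b : ℝ → ℝ) (hb : Measurable b) (n : ℕ) : SimpleFunc ℝ ℝ :=
  SimpleFunc.approxOn b hb univ 0 (mem_univ 0) n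

theorem exists_tendsto (E : SpectralResolution H) {b : ℝ → ℝ} (hb : Measurable b) {x : H}
    (hx : MemLp b 2 (E.measure x)) :
    ∃ y, Tendsto (fun n => E.simpleIntegral (approx b hb n) x) atTop (𝓝 y) := by
  have h0 : Tendsto (fun n => eLpNorm (⇑(approx b hb n) - b) 2 (E.measure x)) atTop (𝓝 0) :=
    SimpleFunc.tendsto_approxOn_Lp_eLpNorm hb (mem_univ 0) (by norm_num) (by simp)
      (by simpa using hx.2)
  refine cauchySeq_tendsto_of_complete (EMetric.cauchySeq_iff.2 fun ε hε => ?_)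
  obtain ⟨N, hN⟩ := eventually_atTop.1 ((tendsto_order.1 h0).2 (ε / 2) (ENNReal.half_pos hε.ne'))
  refine ⟨N, fun m hm n hn => ?_⟩
  rw [edist_eq_enorm_sub, ← E.simpleIntegral_sub, ← ofReal_norm, E.norm_simpleIntegral]
  have he : ⇑(approx b hb m - approx b hb n) = (⇑(approx b hb m) - b) - (⇑(approx b hb n) - b) := by
    simp
  rw [he]
  calc _ ≤ eLpNorm (⇑(approx b hb m) - b) 2 (E.measure x) +
        eLpNorm (⇑(approx b hb n) - b) 2 (E.measure x) :=
        eLpNorm_sub_le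
          ((approx b hb m).measurable.sub hb).aestronglyMeasurable
          ((approx b hb n).measurable.sub hb).aestronglyMeasurable (by norm_num)
    _ < ε / 2 + ε / 2 := ENNReal.add_lt_add (hN m hm) (hN n hn)
    _ = ε := ENNReal.add_halves ε

theorem memLp_add (E : SpectralResolution H) {b : ℝ → ℝ} {x y : H}
    (hx : MemLp b 2 (E.measure x)) (hy : MemLp b 2 (E.measure y)) :
    MemLp b 2 (E.measure (x + y)) := by
  have h : E.measure (x + y) ≤ (2 : ℝ≥0∞) • (E.measure x + E.measure y) := by
    refine Measure.le_iff.2 fun B hB => ?_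
    simp only [Measure.smul_apply, Measure.add_apply, smul_eq_mul, E.measure_apply' _ hB]
    rw [← ENNReal.ofReal_add (by positivity) (by positivity), ← ENNReal.ofReal_ofNat 2,
      ← ENNReal.ofReal_mul (by norm_num)]
    refine ENNReal.ofReal_le_ofReal ?_
    rw [map_add]
    nlinarith [norm_add_le (E.toFun B x) (E.toFun B y), norm_nonneg (E.toFun B x + E.toFun B y),
      norm_nonneg (E.toFun B x), norm_nonneg (E.toFun B y),
      sq_nonneg (‖E.toFun B x‖ - ‖E.toFun B y‖)]
  have hs : MemLp b 2 (E.measure x + E.measure y) := by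
    rw [memLp_two_iff_integrable_sq (hx.1.add_measure hy.1)]
    exact hx.integrable_sq.add_measure hy.integrable_sq
  exact (hs.smul_measure (by norm_num)).mono_measure h

theorem memLp_smul (E : SpectralResolution H) {b : ℝ → ℝ} (c : ℂ) {x : H}
    (hx : MemLp b 2 (E.measure x)) : MemLp b 2 (E.measure (c • x)) := by
  have h : E.measure (c • x) = ENNReal.ofReal (‖c‖ ^ 2) • E.measure x := by
    ext B hB
    simp only [Measure.smul_apply, smul_eq_mul, E.measure_apply' _ hB]
    rw [← ENNReal.ofReal_mul (by positivity), map_smul, norm_smul, mul_pow]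
  rw [h]
  exact hx.smul_measure ENNReal.ofReal_ne_top

/-- The (in general unbounded) operator `∫ b dE` of a Borel function `b : ℝ → ℝ`. Its domain
consists of the vectors `x` with `∫ |b|² d⟪x, E(·) x⟫ < ∞`, and on it `(∫ b dE) x` is the limit of
the integrals of simple functions that tend to `b` in `L²(⟪x, E(·) x⟫)`. -/
def integral (E : SpectralResolution H) (b : ℝ → ℝ) (hb : Measurable b) : H →ₗ.[ℂ] H where
  domain :=
    { carrier := {x | MemLp b 2 (E.measure x)}
      zero_mem' := by
        have h : E.measure 0 = 0 := by
          ext B hB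
          simp [E.measure_apply 0 hB]
        simp [h]
      add_mem' := fun hx hy => E.memLp_add hx hy
      smul_mem' := fun c _ hx => E.memLp_smul c hx }
  toFun :=
    { toFun := fun x => limUnder atTop (fun n => E.simpleIntegral (approx b hb n) (x : H))
      map_add' := by
        intro x y
        refine Tendsto.limUnder_eq ?_
        simp only [Submodule.coe_add, map_add]
        exact (tendsto_nhds_limUnder (E.exists_tendsto hb x.2)).add
          (tendsto_nhds_limUnder (E.exists_tendsto hb y.2))
      map_smul' := by
        intro c x
        refine Tendsto.limUnder_eq ?_
        simp only [Submodule.coe_smul, map_smul, RingHom.id_apply]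
        exact (tendsto_nhds_limUnder (E.exists_tendsto hb x.2)).const_smul c }

/-- `E` is the spectral measure of the operator `A`, that is `A = ∫ r dE(r)`. By the spectral
theorem each self-adjoint operator has exactly one spectral measure. -/
def IsSpectralMeasureOf (E : SpectralResolution H) (A : H →ₗ.[ℂ] H) : Prop :=
  A = E.integral id measurable_id

theorem measure_cumulative (E : SpectralResolution H) (x : H) :
    (E.cumulative x).measure = E.measure x := by
  refine (Measure.ext_of_Ioc _ _ fun r s hrs => ?_).symm
  rw [StieltjesFunction.measure_Ioc]
  change _ = ENNReal.ofReal
    ((⟪x, E.toFun (Iic s) x⟫_ℂ).re - (⟪x, E.toFun (Iic r) x⟫_ℂ).re)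
  rw [← E.measureReal_apply x measurableSet_Iic, ← E.measureReal_apply x measurableSet_Iic,
    ← measureReal_sdiff (Iic_subset_Iic.2 hrs.le) measurableSet_Iic, Iic_sdiff_Iic,
    ofReal_measureReal]

theorem ext_of_measure {E E' : SpectralResolution H}
    (h : ∀ x : H, ‖x‖ = 1 → E.measure x = E'.measure x) : E = E' := by
  have h0 : ∀ B, E.toFun B = E'.toFun B := by
    intro B
    by_cases hB : MeasurableSet B
    · have hq : ∀ (G : SpectralResolution H) (x : H),
          ⟪G.toFun B x, x⟫_ℂ = ((G.measure x).real B : ℂ) := by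
        intro G x
        rw [G.measureReal_apply x hB, ← inner_conj_symm, G.inner_apply hB,
          inner_self_eq_norm_sq_to_K]
        simp [← Complex.ofReal_pow]
      have h1 : ∀ x : H, ‖x‖ = 1 → ⟪E.toFun B x, x⟫_ℂ = ⟪E'.toFun B x, x⟫_ℂ := by
        intro x hx
        rw [hq, hq, h x hx]
      have h2 : (E.toFun B).toLinearMap = (E'.toFun B).toLinearMap := by
        refine (ext_inner_map _ _).1 fun x => ?_
        simp only [ContinuousLinearMap.coe_coe]
        by_cases hx : x = 0
        · simp [hx]
        · have hn : (‖x‖ : ℂ) ≠ 0 := by simpa using hx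
          have h3 := h1 ((‖x‖ : ℂ)⁻¹ • x) (by
            rw [norm_smul, norm_inv, Complex.norm_real, norm_norm,
              inv_mul_cancel₀ (norm_ne_zero_iff.2 hx)])
          simpa [inner_smul_left, inner_smul_right, hn] using h3
      exact ContinuousLinearMap.coe_injective h2
    · rw [E.not_measurable' B hB, E'.not_measurable' B hB]
  cases E
  cases E'
  congr
  exact funext h0

end SpectralResolution

section Observables

variable {H : Type*} [NormedAddCommGroup H] [InnerProductSpace ℂ H] [CompleteSpace H]
  {Z : Type*} [MeasurableSpace Z]

open Classical in
/-- The Borel functional calculus `b(A) = ∫ b dE`, where `E` is the spectral measure of the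
self-adjoint operator `A`. (Operators without a spectral measure get a junk value; no self-adjoint
operator is of this kind.) -/
def borelCalculus (b : ℝ → ℝ) (hb : Measurable b) (A : H →ₗ.[ℂ] H) : H →ₗ.[ℂ] H :=
  if h : ∃ E : SpectralResolution H, E.IsSpectralMeasureOf A then h.choose.integral b hb else ⊥

variable (H) in
/-- The self-adjoint, possibly unbounded, operators on `H`. -/
abbrev SelfAdjointOperator : Type _ := {A : H →ₗ.[ℂ] H // IsSelfAdjoint A}

/-- `f : ℙ(H) × Z → ℝ` is an observable function with associated operator `A`: each section
`f_[ψ] : Z → ℝ` is Borel and its law under `μ_[ψ]` is the Borel measure on the line with cumulative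
function `r ↦ ⟪ψ, E((-∞, r]) ψ⟫`, where `E` is the spectral measure of `A` and `ψ` is a unit vector
in the class `[ψ]`. -/
def IsObservableWith (μ : ℙ ℂ H → Measure Z) (f : ℙ ℂ H × Z → ℝ) (A : SelfAdjointOperator H) :
    Prop :=
  (∀ p : ℙ ℂ H, Measurable fun z => f (p, z)) ∧
  ∃ E : SpectralResolution H, E.IsSpectralMeasureOf (A : H →ₗ.[ℂ] H) ∧
    ∀ (ψ : H) (hψ : ψ ≠ 0), ‖ψ‖ = 1 →
      (μ (Projectivization.mk ℂ ψ hψ)).map (fun z => f (Projectivization.mk ℂ ψ hψ, z)) =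
        (E.cumulative ψ).measure

theorem IsObservableWith.unique {μ : ℙ ℂ H → Measure Z} {f : ℙ ℂ H × Z → ℝ}
    {A A' : SelfAdjointOperator H} (h : IsObservableWith μ f A) (h' : IsObservableWith μ f A') :
    A = A' := by
  obtain ⟨-, E, hE, h⟩ := h
  obtain ⟨-, E', hE', h'⟩ := h'
  have he : E = E' := by
    refine SpectralResolution.ext_of_measure fun x hx => ?_
    have hx0 : x ≠ 0 := by
      rintro rfl
      simp at hx
    rw [← E.measure_cumulative, ← E'.measure_cumulative, ← h x hx0 hx, ← h' x hx0 hx]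
  subst he
  exact Subtype.ext (Eq.trans hE (Eq.symm hE'))

/-- The set of all observable functions. -/
def observableFunctions (μ : ℙ ℂ H → Measure Z) : Set (ℙ ℂ H × Z → ℝ) :=
  {f | ∃ A : SelfAdjointOperator H, IsObservableWith μ f A}

/-- The operator associated to an observable function; it is unique by
`IsObservableWith.unique`. -/
def Op (μ : ℙ ℂ H → Measure Z) (f : observableFunctions μ) : SelfAdjointOperator H :=
  Classical.choose f.2

end Observables

end

/-! Let `E` be the spectral measure of `Op(f)` and push it forward along `b`, to `B ↦ E(b⁻¹ B)`. Its
scalar measures are the images under `b` of those of `E` (`measure_map`), hence the laws of the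
sections of `b ∘ f`. Change of variables gives `∫ r d(b_* E) = ∫ b dE`, domains included
(`integral_id_map`), and every `∫ r dG(r)` is self-adjoint (`isSelfAdjoint_integral_id`). So this
operator serves `b ∘ f`, and by uniqueness it is `Op(b ∘ f)`.

The functional calculus chooses some spectral measure of the operator, so uniqueness of that measure
is also needed (`eq_of_integral_id_eq`). Suppose `A = ∫ r dE = ∫ r dF`. A vector `x` in the range of
`E([c - d, c + d])` satisfies `‖(A - c)ⁿ x‖ ≤ dⁿ ‖x‖`, whereas `F`-mass of `x` at distance at least
`e > d` from `c` would force growth of order `eⁿ`. Hence the range of `E(I)` lies in that of `F(I)`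
for each compact interval `I`, and by symmetry the two projections agree. -/

theorem monotone_Icc_neg_natCast : Monotone fun n : ℕ => Icc (-n : ℝ) n := fun _ _ h =>
  Icc_subset_Icc (neg_le_neg (Nat.cast_le.2 h)) (Nat.cast_le.2 h)

theorem iUnion_Icc_neg_natCast : ⋃ n : ℕ, Icc (-n : ℝ) n = univ := by
  refine eq_univ_of_forall fun t => mem_iUnion.2 ?_
  obtain ⟨n, hn⟩ := exists_nat_ge |t|
  exact ⟨n, abs_le.1 hn⟩

/-! ### Projections, scalar measures and simple integrals. -/

namespace SpectralResolution

variable {H : Type*} [NormedAddCommGroup H] [InnerProductSpace ℂ H] [CompleteSpace H]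

theorem mul_apply (E : SpectralResolution H) {B C : Set ℝ} (hB : MeasurableSet B)
    (hC : MeasurableSet C) (x : H) : E.toFun B (E.toFun C x) = E.toFun (B ∩ C) x := by
  rw [E.inter' B C hB hC]
  rfl

theorem inner_left_eq_inner_right (E : SpectralResolution H) {B : Set ℝ} (hB : MeasurableSet B)
    (x y : H) : ⟪E.toFun B x, y⟫_ℂ = ⟪x, E.toFun B y⟫_ℂ :=
  (E.isStarProjection' B hB).isSelfAdjoint.isSymmetric x y

theorem measure_univ (E : SpectralResolution H) (x : H) :
    E.measure x univ = ENNReal.ofReal (‖x‖ ^ 2) := by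
  rw [E.measure_apply' x MeasurableSet.univ, E.univ']
  rfl

/-- Multiplicativity `E(B) E(C) = E(B ∩ C)` turns truncation of vectors into restriction of
measures. -/
theorem measure_toFun_apply (E : SpectralResolution H) {C : Set ℝ} (hC : MeasurableSet C) (x : H) :
    E.measure (E.toFun C x) = (E.measure x).restrict C := by
  ext B hB
  rw [Measure.restrict_apply hB, E.measure_apply' _ hB, E.measure_apply' _ (hB.inter hC),
    E.mul_apply hB hC]

theorem toFun_simpleIntegral (E : SpectralResolution H) (s : SimpleFunc ℝ ℝ) {C : Set ℝ}
    (hC : MeasurableSet C) (x : H) :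
    E.toFun C (E.simpleIntegral s x) = E.simpleIntegral s (E.toFun C x) := by
  simp only [simpleIntegral, sum_apply, smul_apply, map_sum, map_smul]
  refine Finset.sum_congr rfl fun c _ => ?_
  rw [E.mul_apply hC (s.measurableSet_fiber c), E.mul_apply (s.measurableSet_fiber c) hC,
    inter_comm]

theorem inner_simpleIntegral (E : SpectralResolution H) (s : SimpleFunc ℝ ℝ) (x y : H) :
    ⟪E.simpleIntegral s x, y⟫_ℂ = ⟪x, E.simpleIntegral s y⟫_ℂ := by
  simp only [simpleIntegral, sum_apply, smul_apply, sum_inner, inner_sum]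
  refine Finset.sum_congr rfl fun c _ => ?_
  rw [inner_smul_left, inner_smul_right, Complex.conj_ofReal,
    E.inner_left_eq_inner_right (s.measurableSet_fiber c)]

theorem simpleIntegral_const (E : SpectralResolution H) (c : ℝ) (x : H) :
    E.simpleIntegral (SimpleFunc.const ℝ c) x = (c : ℂ) • x := by
  have h : (SimpleFunc.const ℝ c).range = {c} := SimpleFunc.range_const ℝ c
  rw [simpleIntegral, h, Finset.sum_singleton]
  have h' : (SimpleFunc.const ℝ c : ℝ → ℝ) ⁻¹' {c} = univ := by
    ext t
    simp
  rw [h', E.univ']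
  rfl

/-! ### The integral of a Borel function. -/

variable {b : ℝ → ℝ} {hb : Measurable b}

theorem tendsto_eLpNorm_approx (E : SpectralResolution H) (hb : Measurable b) {x : H}
    (hx : MemLp b 2 (E.measure x)) :
    Tendsto (fun n => eLpNorm (⇑(approx b hb n) - b) 2 (E.measure x)) atTop (𝓝 0) :=
  SimpleFunc.tendsto_approxOn_Lp_eLpNorm hb (mem_univ 0) (by norm_num) (by simp)
    (by simpa using hx.2)

theorem tendsto_approx (E : SpectralResolution H) {x : H} (hx : MemLp b 2 (E.measure x)) :
    Tendsto (fun n => E.simpleIntegral (approx b hb n) x) atTop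
      (𝓝 (E.integral b hb ⟨x, hx⟩)) :=
  tendsto_nhds_limUnder (E.exists_tendsto hb hx)

/-- The integral of `b` is the limit of the integrals of any simple functions that tend to `b`
in `L²`. -/
theorem tendsto_simpleIntegral (E : SpectralResolution H) {x : H}
    (hx : MemLp b 2 (E.measure x)) {s : ℕ → SimpleFunc ℝ ℝ}
    (hs : Tendsto (fun n => eLpNorm (⇑(s n) - b) 2 (E.measure x)) atTop (𝓝 0)) :
    Tendsto (fun n => E.simpleIntegral (s n) x) atTop (𝓝 (E.integral b hb ⟨x, hx⟩)) := by
  -- By the isometry for simple functions, the distance to the standard approximants is an `L²`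
  -- distance.
  have h0 : Tendsto (fun n => E.simpleIntegral (s n) x - E.simpleIntegral (approx b hb n) x) atTop
      (𝓝 0) := by
    rw [tendsto_zero_iff_norm_tendsto_zero]
    have h1 : Tendsto (fun n => eLpNorm (⇑(s n) - b) 2 (E.measure x) +
        eLpNorm (⇑(approx b hb n) - b) 2 (E.measure x)) atTop (𝓝 0) := by
      simpa using hs.add (E.tendsto_eLpNorm_approx hb hx)
    have h2 : Tendsto (fun n => ENNReal.ofReal
        ‖E.simpleIntegral (s n) x - E.simpleIntegral (approx b hb n) x‖) atTop (𝓝 0) := by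
      refine tendsto_of_tendsto_of_tendsto_of_le_of_le tendsto_const_nhds h1
        (fun _ => zero_le) fun n => ?_
      change ENNReal.ofReal _ ≤ _
      rw [← E.simpleIntegral_sub, E.norm_simpleIntegral]
      have he : ⇑(s n - approx b hb n) = (⇑(s n) - b) - (⇑(approx b hb n) - b) := by simp
      rw [he]
      exact eLpNorm_sub_le ((s n).measurable.sub hb).aestronglyMeasurable
        ((approx b hb n).measurable.sub hb).aestronglyMeasurable (by norm_num)
    have h3 := (ENNReal.tendsto_toReal ENNReal.zero_ne_top).comp h2
    refine h3.congr fun n => ENNReal.toReal_ofReal (norm_nonneg _)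
  simpa using h0.add (E.tendsto_approx (hb := hb) hx)

/-- The isometry for simple functions passes to the limit, since both the vectors and the `L²` norms
converge. -/
theorem norm_integral (E : SpectralResolution H) {x : H} (hx : MemLp b 2 (E.measure x)) :
    ENNReal.ofReal ‖E.integral b hb ⟨x, hx⟩‖ = eLpNorm b 2 (E.measure x) := by
  have h1 : Tendsto (fun n => ENNReal.ofReal ‖E.simpleIntegral (approx b hb n) x‖) atTop
      (𝓝 (ENNReal.ofReal ‖E.integral b hb ⟨x, hx⟩‖)) :=
    (ENNReal.continuous_ofReal.tendsto _).comp (E.tendsto_approx hx).norm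
  simp only [E.norm_simpleIntegral] at h1
  have h2 : Tendsto (fun n => eLpNorm (approx b hb n) 2 (E.measure x)) atTop
      (𝓝 (eLpNorm b 2 (E.measure x))) := by
    have h0 := E.tendsto_eLpNorm_approx hb hx
    have hm : ∀ n, AEStronglyMeasurable (⇑(approx b hb n) - b) (E.measure x) := fun n =>
      ((approx b hb n).measurable.sub hb).aestronglyMeasurable
    refine tendsto_of_tendsto_of_tendsto_of_le_of_le (f := fun n => eLpNorm (approx b hb n) 2 (E.measure x))
      (g := fun n => eLpNorm b 2 (E.measure x) - eLpNorm (⇑(approx b hb n) - b) 2 (E.measure x))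
      (h := fun n => eLpNorm b 2 (E.measure x) + eLpNorm (⇑(approx b hb n) - b) 2 (E.measure x))
      ?_ ?_ ?_ ?_
    · simpa using ENNReal.Tendsto.sub tendsto_const_nhds h0 (Or.inl hx.2.ne)
    · simpa using tendsto_const_nhds.add h0
    · intro n
      change _ - _ ≤ _
      rw [tsub_le_iff_right]
      have he : b = ⇑(approx b hb n) - (⇑(approx b hb n) - b) := by simp
      conv_lhs => rw [he]
      exact eLpNorm_sub_le (approx b hb n).measurable.aestronglyMeasurable (hm n) (by norm_num)
    · intro n
      beta_reduce
      have he : ⇑(approx b hb n) = b + (⇑(approx b hb n) - b) := by simp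
      conv_lhs => rw [he]
      exact eLpNorm_add_le hb.aestronglyMeasurable (hm n) (by norm_num)
  exact tendsto_nhds_unique h1 h2

theorem memLp_toFun (E : SpectralResolution H) {C : Set ℝ} (hC : MeasurableSet C) {x : H}
    (hx : MemLp b 2 (E.measure x)) : MemLp b 2 (E.measure (E.toFun C x)) := by
  rw [E.measure_toFun_apply hC]
  exact hx.restrict C

theorem toFun_integral (E : SpectralResolution H) {C : Set ℝ} (hC : MeasurableSet C) {x : H}
    (hx : MemLp b 2 (E.measure x)) :
    E.toFun C (E.integral b hb ⟨x, hx⟩) =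
      E.integral b hb ⟨E.toFun C x, E.memLp_toFun hC hx⟩ := by
  have h1 := ((E.toFun C).continuous.tendsto _).comp (E.tendsto_approx (hb := hb) hx)
  have h2 := E.tendsto_approx (hb := hb) (E.memLp_toFun hC hx)
  refine tendsto_nhds_unique h1 (h2.congr fun n => ?_)
  exact (E.toFun_simpleIntegral _ hC x).symm

/-- This is the isometry applied to `E(C) x`, as `E(C)` commutes with the integral. It is the source
of all growth and domain estimates below. -/
theorem measure_integral (E : SpectralResolution H) {C : Set ℝ} (hC : MeasurableSet C) {x : H}
    (hx : MemLp b 2 (E.measure x)) :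
    E.measure (E.integral b hb ⟨x, hx⟩) C = ∫⁻ t in C, ‖b t‖ₑ ^ 2 ∂(E.measure x) := by
  rw [E.measure_apply' _ hC, E.toFun_integral hC, ENNReal.ofReal_pow (norm_nonneg _),
    E.norm_integral, E.measure_toFun_apply hC,
    eLpNorm_eq_lintegral_rpow_enorm_toReal (by norm_num) (by norm_num)]
  simp only [ENNReal.toReal_ofNat, ENNReal.rpow_ofNat]
  rw [← ENNReal.rpow_natCast, ← ENNReal.rpow_mul]
  norm_num

theorem inner_integral (E : SpectralResolution H) {x y : H} (hx : MemLp b 2 (E.measure x))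
    (hy : MemLp b 2 (E.measure y)) :
    ⟪E.integral b hb ⟨x, hx⟩, y⟫_ℂ = ⟪x, E.integral b hb ⟨y, hy⟩⟫_ℂ := by
  have h1 := (E.tendsto_approx (hb := hb) hx).inner (𝕜 := ℂ) (tendsto_const_nhds (x := y))
  have h2 := (tendsto_const_nhds (x := x)).inner (𝕜 := ℂ) (E.tendsto_approx (hb := hb) hy)
  refine tendsto_nhds_unique h1 (h2.congr fun n => ?_)
  exact (E.inner_simpleIntegral _ x y).symm

/-- The shifted approximants of `b` need not be the standard ones of `b - c`, so freedom in the
choice of approximants is used. -/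
theorem integral_sub_const (E : SpectralResolution H) (c : ℝ) {x : H}
    (hx : MemLp b 2 (E.measure x)) :
    E.integral (fun t => b t - c) (hb.sub_const c) ⟨x, hx.sub (memLp_const c)⟩ =
      E.integral b hb ⟨x, hx⟩ - (c : ℂ) • x := by
  have h1 := E.tendsto_simpleIntegral (hb := hb.sub_const c) (hx.sub (memLp_const c))
    (s := fun n => approx b hb n - SimpleFunc.const ℝ c) (by
      refine (E.tendsto_eLpNorm_approx hb hx).congr fun n => ?_
      congr 1
      ext t
      simp)
  have h2 := (E.tendsto_approx (hb := hb) hx).sub (tendsto_const_nhds (x := (c : ℂ) • x))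
  refine tendsto_nhds_unique h1 (h2.congr fun n => ?_)
  rw [E.simpleIntegral_sub, E.simpleIntegral_const]

/-! ### Truncation to compact intervals and self-adjointness. -/

theorem memLp_toFun_Icc (E : SpectralResolution H) (r s : ℝ) (x : H) :
    MemLp id 2 (E.measure (E.toFun (Icc r s) x)) := by
  rw [E.measure_toFun_apply measurableSet_Icc]
  refine MemLp.of_bound measurable_id.aestronglyMeasurable (max |r| |s|) ?_
  refine (ae_restrict_mem measurableSet_Icc).mono fun t ht => ?_
  exact abs_le_max_abs_abs ht.1 ht.2

/-- For a projection, `‖P x - x‖² = ‖x‖² - ‖P x‖²`, and the right side tends to `0` by continuity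
from below of the scalar measure. -/
theorem tendsto_toFun_Icc (E : SpectralResolution H) (x : H) :
    Tendsto (fun n : ℕ => E.toFun (Icc (-n : ℝ) n) x) atTop (𝓝 x) := by
  have h := tendsto_measure_iUnion_atTop (μ := E.measure x) monotone_Icc_neg_natCast
  rw [iUnion_Icc_neg_natCast] at h
  have h' := (ENNReal.tendsto_toReal (measure_ne_top _ _)).comp h
  rw [E.measure_univ, ENNReal.toReal_ofReal (by positivity)] at h'
  have h1 : Tendsto (fun n : ℕ => ‖x‖ ^ 2 - ‖E.toFun (Icc (-n : ℝ) n) x‖ ^ 2) atTop (𝓝 0) := by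
    rw [← sub_self (‖x‖ ^ 2)]
    refine tendsto_const_nhds.sub (h'.congr fun n => ?_)
    change (E.measure x (Icc (-n : ℝ) n)).toReal = _
    rw [E.measure_apply' x measurableSet_Icc, ENNReal.toReal_ofReal (by positivity)]
  have h2 : Tendsto (fun n : ℕ => √(‖x‖ ^ 2 - ‖E.toFun (Icc (-n : ℝ) n) x‖ ^ 2)) atTop (𝓝 0) := by
    have h := (Real.continuous_sqrt.tendsto 0).comp h1
    rwa [Real.sqrt_zero] at h
  rw [tendsto_iff_norm_sub_tendsto_zero]
  refine h2.congr fun n => ?_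
  have h3 : ‖x‖ ^ 2 - ‖E.toFun (Icc (-n : ℝ) n) x‖ ^ 2 = ‖E.toFun (Icc (-n : ℝ) n) x - x‖ ^ 2 := by
    have h4 : RCLike.re ⟪x, E.toFun (Icc (-n : ℝ) n) x⟫_ℂ = _ :=
      E.re_inner_apply measurableSet_Icc x
    rw [norm_sub_rev, norm_sub_sq (𝕜 := ℂ), h4]
    ring
  rw [h3, Real.sqrt_sq (norm_nonneg _)]

theorem dense_domain_integral_id (E : SpectralResolution H) :
    Dense ((E.integral id measurable_id).domain : Set H) := fun x =>
  mem_closure_of_tendsto (E.tendsto_toFun_Icc x)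
    (Eventually.of_forall fun _ => E.memLp_toFun_Icc _ _ x)

/-- The operator `∫ r dE(r)` is self-adjoint. -/
theorem isSelfAdjoint_integral_id (E : SpectralResolution H) :
    IsSelfAdjoint (E.integral id measurable_id) := by
  have hd := E.dense_domain_integral_id
  rw [LinearPMap.isSelfAdjoint_def]
  have hf : (E.integral id measurable_id).IsFormalAdjoint (E.integral id measurable_id) :=
    fun x y => E.inner_integral x.2 y.2
  refine (LinearPMap.eq_of_le_of_domain_eq (hf.le_adjoint hd) ?_).symm
  refine le_antisymm (hf.le_adjoint hd).1 fun y hy => ?_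
  set w := (E.integral id measurable_id).adjoint ⟨y, hy⟩ with hw
  -- Testing the adjoint relation on truncated vectors, which lie in the domain, yields `A E(I) y =
  -- E(I) w`.
  have h1 : ∀ n : ℕ, E.integral id measurable_id ⟨_, E.memLp_toFun_Icc (-n : ℝ) n y⟩ =
      E.toFun (Icc (-n : ℝ) n) w := by
    intro n
    refine hd.eq_of_inner_left ℂ fun x hx => ?_
    rw [E.inner_left_eq_inner_right measurableSet_Icc,
      LinearPMap.adjoint_isFormalAdjoint hd ⟨y, hy⟩ ⟨_, E.memLp_toFun_Icc (-n : ℝ) n x⟩,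
      E.inner_integral _ hx, E.inner_left_eq_inner_right measurableSet_Icc,
      E.toFun_integral measurableSet_Icc hx]
  -- The bound is uniform in `n`, so monotone convergence puts `y` in the domain of `A`.
  have h2 : ∀ n : ℕ, ∫⁻ t in Icc (-n : ℝ) n, ‖t‖ₑ ^ 2 ∂(E.measure y) ≤
      ENNReal.ofReal (‖w‖ ^ 2) := by
    intro n
    have h3 := E.measure_integral (hb := measurable_id) MeasurableSet.univ
      (E.memLp_toFun_Icc (-n : ℝ) n y)
    rw [h1, E.measure_toFun_apply measurableSet_Icc, E.measure_toFun_apply measurableSet_Icc,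
      Measure.restrict_univ] at h3
    simp only [id] at h3
    rw [← h3, ← E.measure_univ]
    exact Measure.restrict_apply_le _ _
  change MemLp id 2 (E.measure y)
  refine ⟨measurable_id.aestronglyMeasurable, ?_⟩
  rw [eLpNorm_lt_top_iff_lintegral_rpow_enorm_lt_top (by norm_num) (by norm_num)]
  simp only [ENNReal.toReal_ofNat, ENNReal.rpow_ofNat, id]
  rw [← Measure.restrict_univ (μ := E.measure y), ← iUnion_Icc_neg_natCast,
    setLIntegral_iUnion_of_directed _ monotone_Icc_neg_natCast.directed_le]
  exact (iSup_le h2).trans_lt ENNReal.ofReal_lt_top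

/-! ### Uniqueness of the spectral measure. -/

/-- If `A = ∫ r dE(r) = ∫ r dF(r)` and `x` is in the range of `E([c - d, c + d])`, then the vector
`y = (A - c)ⁿ x` satisfies an upper bound in terms of `E` and a lower bound in terms of `F`. -/
theorem exists_iterate (E F : SpectralResolution H)
    (h : E.integral id measurable_id = F.integral id measurable_id) {c d e : ℝ}
    (he : 0 ≤ e) {x : H} (hx : E.toFun (Icc (c - d) (c + d)) x = x) (n : ℕ) :
    ∃ y : H, E.toFun (Icc (c - d) (c + d)) y = y ∧
      ENNReal.ofReal (‖y‖ ^ 2) ≤ ENNReal.ofReal (d ^ 2) ^ n * ENNReal.ofReal (‖x‖ ^ 2) ∧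
      ENNReal.ofReal (e ^ 2) ^ n * F.measure x {t | e ≤ |t - c|} ≤
        F.measure y {t | e ≤ |t - c|} := by
  have hC : MeasurableSet {t : ℝ | e ≤ |t - c|} := by measurability
  induction n with
  | zero => exact ⟨x, hx, by simp, by simp⟩
  | succ n ih =>
    obtain ⟨y, hy, h1, h2⟩ := ih
    have hyE : MemLp id 2 (E.measure y) := hy ▸ E.memLp_toFun_Icc (c - d) (c + d) y
    -- Only equality of the domains gives this: nothing is known yet about the support of `F.measure
    -- y`.
    have hyF : MemLp id 2 (F.measure y) := by
      change y ∈ (F.integral id measurable_id).domain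
      rw [← h]
      exact hyE
    have h3 : E.integral id measurable_id ⟨y, hyE⟩ = F.integral id measurable_id ⟨y, hyF⟩ :=
      (LinearPMap.ext_iff.1 h).2 (x := y) (hf := hyE) (hg := hyF)
    have h4 := E.integral_sub_const (hb := measurable_id) c hyE
    have h5 := F.integral_sub_const (hb := measurable_id) c hyF
    set z := E.integral id measurable_id ⟨y, hyE⟩ - (c : ℂ) • y with hz
    rw [← h3, ← hz] at h5
    refine ⟨z, ?_, ?_, ?_⟩
    · rw [hz, map_sub, map_smul, hy, E.toFun_integral measurableSet_Icc]
      simp only [hy]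
    · rw [← E.measure_univ, ← h4, E.measure_integral MeasurableSet.univ, Measure.restrict_univ,
        pow_succ', mul_assoc]
      refine le_trans ?_ (mul_le_mul_right h1 _)
      -- Since `E(I) y = y`, the measure of `y` lives on `I`, where `|t - c| ≤ d`.
      rw [← E.measure_univ, ← hy, E.measure_toFun_apply measurableSet_Icc, ← lintegral_const]
      refine lintegral_mono_ae ((ae_restrict_mem measurableSet_Icc).mono fun t ht => ?_)
      rw [← ofReal_norm, ← ENNReal.ofReal_pow (norm_nonneg _)]
      refine ENNReal.ofReal_le_ofReal (pow_le_pow_left₀ (norm_nonneg _) ?_ 2)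
      rw [Real.norm_eq_abs, abs_le]
      simp only [id]
      constructor <;> linarith [ht.1, ht.2]
    · rw [← h5, F.measure_integral hC, pow_succ', mul_assoc]
      refine (mul_le_mul_right h2 _).trans ?_
      rw [← setLIntegral_const]
      refine setLIntegral_mono_ae' hC (Eventually.of_forall fun t ht => ?_)
      rw [← ofReal_norm, ← ENNReal.ofReal_pow (norm_nonneg _)]
      exact ENNReal.ofReal_le_ofReal (pow_le_pow_left₀ he ht 2)

theorem toFun_Icc_apply_of_integral_eq (E F : SpectralResolution H)
    (h : E.integral id measurable_id = F.integral id measurable_id) {c d : ℝ} (hd : 0 ≤ d)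
    {x : H} (hx : E.toFun (Icc (c - d) (c + d)) x = x) :
    F.toFun (Icc (c - d) (c + d)) x = x := by
  have h0 : ∀ e : ℝ, d < e → F.measure x {t | e ≤ |t - c|} = 0 := by
    intro e hde
    have he : 0 < e := hd.trans_lt hde
    have hC : MeasurableSet {t : ℝ | e ≤ |t - c|} := by measurability
    -- Both bounds on `(A - c)ⁿ x` combine to a geometric decay, with ratio below `1` because `d <
    -- e`.
    have h1 : ∀ n : ℕ, (F.measure x).real {t | e ≤ |t - c|} ≤ ((d ^ 2) / (e ^ 2)) ^ n * ‖x‖ ^ 2 := by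
      intro n
      obtain ⟨y, -, h1, h2⟩ := exists_iterate E F h he.le hx n
      have h3 := (h2.trans (measure_mono (subset_univ _))).trans ((F.measure_univ y).le.trans h1)
      rw [← ENNReal.ofReal_pow (by positivity), ← ENNReal.ofReal_pow (by positivity),
        ← ofReal_measureReal, ← ENNReal.ofReal_mul (by positivity),
        ← ENNReal.ofReal_mul (by positivity), ENNReal.ofReal_le_ofReal_iff (by positivity)] at h3
      rw [div_pow, div_mul_eq_mul_div, le_div_iff₀ (by positivity), mul_comm]
      exact h3
    have h2 : Tendsto (fun n : ℕ => ((d ^ 2) / (e ^ 2)) ^ n * ‖x‖ ^ 2) atTop (𝓝 0) := by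
      have h3 : (d ^ 2) / (e ^ 2) < 1 := by
        rw [div_lt_one (by positivity)]
        exact pow_lt_pow_left₀ hde hd two_ne_zero
      simpa using (tendsto_pow_atTop_nhds_zero_of_lt_one (by positivity) h3).mul_const (‖x‖ ^ 2)
    exact (measureReal_eq_zero_iff).1
      (le_antisymm (ge_of_tendsto' h2 h1) measureReal_nonneg)
  have h1 : F.measure x (Icc (c - d) (c + d))ᶜ = 0 := by
    -- The decay needs `e > d` strictly, so the complement is exhausted by the thresholds `d + 1 /
    -- (n + 1)`.
    have hU : (Icc (c - d) (c + d))ᶜ ⊆ ⋃ n : ℕ, {t | d + 1 / ((n : ℝ) + 1) ≤ |t - c|} := by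
      intro t ht
      have ht' : d < |t - c| := by
        by_contra! hle
        obtain ⟨h1, h2⟩ := abs_le.1 hle
        exact ht ⟨by linarith, by linarith⟩
      obtain ⟨n, hn⟩ := exists_nat_one_div_lt (sub_pos.2 ht')
      exact mem_iUnion.2 ⟨n, by simp only [mem_ofPred_eq]; linarith⟩
    refine measure_mono_null hU (measure_iUnion_null fun n => h0 _ ?_)
    have : 0 < 1 / ((n : ℝ) + 1) := by positivity
    linarith
  have h2 : F.measure x (Icc (c - d) (c + d)) = F.measure x univ := by
    rw [← measure_add_measure_compl (measurableSet_Icc (a := c - d) (b := c + d)), h1, add_zero]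
  rw [F.measure_univ, F.measure_apply' x measurableSet_Icc,
    ENNReal.ofReal_eq_ofReal_iff (by positivity) (by positivity)] at h2
  have h3 : RCLike.re ⟪x, F.toFun (Icc (c - d) (c + d)) x⟫_ℂ = _ :=
    F.re_inner_apply measurableSet_Icc x
  have h4 : ‖x - F.toFun (Icc (c - d) (c + d)) x‖ ^ 2 = 0 := by
    rw [norm_sub_sq (𝕜 := ℂ), h3, h2]
    ring
  exact (sub_eq_zero.1 (norm_eq_zero.1 (pow_eq_zero_iff two_ne_zero |>.1 h4))).symm

/-- The spectral measure is determined by the operator `∫ r dE(r)`. -/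
theorem eq_of_integral_id_eq {E F : SpectralResolution H}
    (h : E.integral id measurable_id = F.integral id measurable_id) : E = F := by
  have key : ∀ E F : SpectralResolution H, E.integral id measurable_id = F.integral id measurable_id →
      ∀ r s : ℝ, r ≤ s → ∀ x, F.toFun (Icc r s) (E.toFun (Icc r s) x) = E.toFun (Icc r s) x := by
    intro E F h r s hrs x
    have h1 : Icc r s = Icc ((r + s) / 2 - (s - r) / 2) ((r + s) / 2 + (s - r) / 2) := by
      congr 1 <;> ring
    rw [h1]
    refine toFun_Icc_apply_of_integral_eq E F h (by linarith) ?_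
    rw [E.mul_apply measurableSet_Icc measurableSet_Icc, inter_self]
  refine ext_of_measure fun x _ => Measure.ext_of_Icc _ _ fun r s hrs => ?_
  -- From `F(I) E(I) = E(I)` and `E(I) F(I) = F(I)`, taking adjoints in the first gives `E(I) = E(I)
  -- F(I) = F(I)`.
  have h1 : E.toFun (Icc r s) x = F.toFun (Icc r s) x := by
    refine ext_inner_right ℂ fun y => ?_
    rw [← key E F h r s hrs x, F.inner_left_eq_inner_right measurableSet_Icc,
      E.inner_left_eq_inner_right measurableSet_Icc, key F E h.symm r s hrs y,
      F.inner_left_eq_inner_right measurableSet_Icc]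
  rw [E.measure_apply' x measurableSet_Icc, F.measure_apply' x measurableSet_Icc, h1]

/-! ### Image spectral measures and change of variables. -/

open Classical in
/-- The image of a spectral resolution under a Borel function. -/
noncomputable def map (E : SpectralResolution H) (b : ℝ → ℝ) (hb : Measurable b) :
    SpectralResolution H where
  toFun B := if MeasurableSet B then E.toFun (b ⁻¹' B) else 0
  not_measurable' B hB := if_neg hB
  isStarProjection' B hB := by
    rw [if_pos hB]
    exact E.isStarProjection' _ (hb hB)
  univ' := by
    rw [if_pos MeasurableSet.univ, preimage_univ, E.univ']
  inter' B C hB hC := by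
    rw [if_pos hB, if_pos hC, if_pos (hB.inter hC), preimage_inter, E.inter' _ _ (hb hB) (hb hC)]
  hasSum' B hB hd x := by
    simp only [if_pos (hB _), if_pos (MeasurableSet.iUnion hB), preimage_iUnion]
    exact E.hasSum' _ (fun n => hb (hB n)) (fun m n hmn => (hd hmn).preimage b) x

theorem map_toFun (E : SpectralResolution H) {B : Set ℝ} (hB : MeasurableSet B) :
    (E.map b hb).toFun B = E.toFun (b ⁻¹' B) :=
  if_pos hB

theorem measure_map (E : SpectralResolution H) (x : H) :
    (E.map b hb).measure x = (E.measure x).map b := by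
  ext B hB
  rw [Measure.map_apply hb hB, measure_apply' _ _ hB, measure_apply' _ _ (hb hB), E.map_toFun hB]

theorem simpleIntegral_map (E : SpectralResolution H) (s : SimpleFunc ℝ ℝ) :
    (E.map b hb).simpleIntegral s = E.simpleIntegral (s.comp b hb) := by
  simp only [simpleIntegral]
  have h : (s.comp b hb).range ⊆ s.range := s.range_comp_subset_range hb
  rw [Finset.sum_congr rfl fun c _ => by rw [E.map_toFun (s.measurableSet_fiber c)]]
  symm
  -- Values of `s` that `s ∘ b` does not take contribute `E(∅) = 0`.
  refine Finset.sum_subset h fun c _ hc => ?_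
  have h' : ⇑(s.comp b hb) ⁻¹' {c} = ∅ := SimpleFunc.preimage_eq_empty_iff _ _ |>.2 hc
  rw [h', E.empty, smul_zero]

/-- Approximants of `id` composed with `b` converge to `b` in `L²` of the original measure, and
their simple integrals coincide with those of the image. -/
theorem integral_id_map (E : SpectralResolution H) :
    (E.map b hb).integral id measurable_id = E.integral b hb := by
  have hm : ∀ x : H, MemLp id 2 ((E.map b hb).measure x) ↔ MemLp b 2 (E.measure x) := by
    intro x
    rw [measure_map, memLp_map_measure_iff measurable_id.aestronglyMeasurable hb.aemeasurable]
    rfl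
  refine LinearPMap.ext (Submodule.ext hm) fun x hx hx' => ?_
  have h1 := (E.map b hb).tendsto_approx (hb := measurable_id) hx
  have h2 := E.tendsto_simpleIntegral (hb := hb) hx'
    (s := fun n => (approx id measurable_id n).comp b hb) (by
      refine ((E.map b hb).tendsto_eLpNorm_approx measurable_id hx).congr fun n => ?_
      rw [measure_map, eLpNorm_map_measure
        ((approx id measurable_id n).measurable.sub measurable_id).aestronglyMeasurable
        hb.aemeasurable]
      rfl)
  refine tendsto_nhds_unique h1 (h2.congr fun n => ?_)
  rw [simpleIntegral_map]

theorem borelCalculus_eq (E : SpectralResolution H) {A : H →ₗ.[ℂ] H}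
    (hE : E.IsSpectralMeasureOf A) : borelCalculus b hb A = E.integral b hb := by
  have h : ∃ E : SpectralResolution H, E.IsSpectralMeasureOf A := ⟨E, hE⟩
  rw [borelCalculus, dif_pos h, eq_of_integral_id_eq (h.choose_spec.symm.trans hE)]

end SpectralResolution

/-! ### The theorem on compositions. -/

theorem mainTheorem12 {H : Type*} [NormedAddCommGroup H] [InnerProductSpace ℂ H] [CompleteSpace H]
    [TopologicalSpace.SeparableSpace H] (hH : ¬ FiniteDimensional ℂ H)
    {Z : Type*} [MeasurableSpace Z] [StandardBorelSpace Z] [Uncountable Z]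
    (μ : ℙ ℂ H → Measure Z) [∀ p, IsProbabilityMeasure (μ p)] [∀ p, NullSingletonClass (μ p)]
    (f : ℙ ℂ H × Z → ℝ) (hf : f ∈ observableFunctions μ) (b : ℝ → ℝ) (hb : Measurable b) :
    ∃ hbf : b ∘ f ∈ observableFunctions μ,
      (Op μ ⟨b ∘ f, hbf⟩ : H →ₗ.[ℂ] H) = borelCalculus b hb (Op μ ⟨f, hf⟩ : H →ₗ.[ℂ] H) := by
  obtain ⟨hm, E, hE, hmap⟩ : IsObservableWith μ f (Op μ ⟨f, hf⟩) := Classical.choose_spec hf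
  have hbf : IsObservableWith μ (b ∘ f)
      ⟨(E.map b hb).integral id measurable_id, (E.map b hb).isSelfAdjoint_integral_id⟩ := by
    refine ⟨fun p => hb.comp (hm p), E.map b hb, rfl, fun ψ hψ h1 => ?_⟩
    rw [SpectralResolution.measure_cumulative, E.measure_map, ← E.measure_cumulative,
      ← hmap ψ hψ h1, Measure.map_map hb (hm _)]
    rfl
  refine ⟨⟨_, hbf⟩, ?_⟩
  have hO : IsObservableWith μ (b ∘ f) (Op μ ⟨b ∘ f, ⟨_, hbf⟩⟩) :=
    Classical.choose_spec (p := IsObservableWith μ (b ∘ f)) ⟨_, hbf⟩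
  -- Both arbitrary choices are removed here: that of the spectral measure, and then that of the
  -- operator of `b ∘ f`.
  rw [E.borelCalculus_eq hE, ← E.integral_id_map]
  exact congrArg Subtype.val (hO.unique hbf)
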